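/- Let $\zeta$ be the Riemann zeta function and $\psi=\Gamma'/\Gamma$ the digamma function, and let $\gamma_k$ $(k\ge 0)$ be the Stieltjes constants, defined by the Laurent expansion $$\zeta(s)=\frac{1}{s-1}+\sum_{k=0}^{\infty}\frac{(-1)^k\gamma_k\,(s-1)^k}{k!}$$ at $s=1$. Let $F(s)=\zeta(s)-\psi(1-s)$, regarded as a real-valued function on the interval $0<s<1$. Then: 1. $F''(s)>0$ for all $s\in(0,1)$, and $F$ is strictly convex on $(0,1)$. 2. $F'(s)>0$ for all $s\in(0,1)$, and $F$ is strictly increasing on $(0,1)$. 3. $$\lim_{s\to0^+}F'(s)=\frac{\pi^2}{6}-\frac12\log(2\pi),\qquad \lim_{s\to1^-}F'(s)=\frac{\pi^2}{6}-\gamma_1 .$$ -/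

import Mathlib

open Set Filter Topology

/-- The function `F(s) = ζ(s) - ψ(1 - s)` of a real variable, `ψ = Γ'/Γ` being the digamma function.
The right-hand side is real for real `s` (see `ofReal_zetaSubDigamma`), so taking the real part
only serves to view it as a real number. -/
noncomputable def zetaSubDigamma (s : ℝ) : ℝ :=
  (riemannZeta (s : ℂ) - Complex.digamma (1 - (s : ℂ))).re

theorem digamma_conj (z : ℂ) :
    Complex.digamma ((starRingEnd ℂ) z) = (starRingEnd ℂ) (Complex.digamma z) := by
  have h : (starRingEnd ℂ) ∘ Complex.Gamma ∘ (starRingEnd ℂ) = Complex.Gamma := by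
    funext w
    simp [Complex.Gamma_conj]
  have h2 : deriv Complex.Gamma ((starRingEnd ℂ) z) = (starRingEnd ℂ) (deriv Complex.Gamma z) := by
    conv_lhs => rw [← h]
    rw [deriv_conj_conj]
    simp
  simp only [Complex.digamma_def, logDeriv_apply, h2, Complex.Gamma_conj, map_div₀]

/-- `ζ(s) - ψ(1 - s)` is real for real `s`. -/
theorem ofReal_zetaSubDigamma (s : ℝ) :
    (zetaSubDigamma s : ℂ) = riemannZeta (s : ℂ) - Complex.digamma (1 - (s : ℂ)) := by
  unfold zetaSubDigamma
  rw [← Complex.conj_eq_iff_re, map_sub, ← riemannZeta_conj, ← digamma_conj]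
  simp

/-- The `k`-th Stieltjes constant `γ_k`, given by the Laurent expansion
`ζ(s) = 1 / (s - 1) + ∑ k, (-1) ^ k * γ_k * (s - 1) ^ k / k!` at `s = 1`
(see `hasSum_stieltjesConstant`). Here `riemannZeta₀` is the entire function
`ζ(s) - 1 / (s - 1)`, with its removable singularity at `s = 1` filled in. -/
noncomputable def stieltjesConstant (k : ℕ) : ℝ :=
  ((-1) ^ k * iteratedDeriv k riemannZeta₀ 1).re

theorem iteratedDeriv_riemannZeta₀_conj (k : ℕ) (z : ℂ) :
    iteratedDeriv k riemannZeta₀ ((starRingEnd ℂ) z) =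
      (starRingEnd ℂ) (iteratedDeriv k riemannZeta₀ z) := by
  induction k generalizing z with
  | zero =>
    by_cases hz : z = 1
    · simp [hz]
    · have hz' : (starRingEnd ℂ) z ≠ 1 := by
        simpa using (map_ne_one_iff _ (starRingEnd ℂ).injective).mpr hz
      simp [riemannZeta₀, hz, hz']
  | succ k ih =>
    have h : (starRingEnd ℂ) ∘ iteratedDeriv k riemannZeta₀ ∘ (starRingEnd ℂ) =
        iteratedDeriv k riemannZeta₀ := by
      funext w
      simp [ih]
    simp only [iteratedDeriv_succ]
    conv_lhs => rw [← h]
    rw [deriv_conj_conj]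
    simp

/-- The Laurent expansion of `ζ` at `s = 1`, which characterises the Stieltjes constants. -/
theorem hasSum_stieltjesConstant {s : ℂ} (hs : s ≠ 1) :
    HasSum (fun k : ℕ => (-1) ^ k * (stieltjesConstant k : ℂ) * (s - 1) ^ k / (k.factorial : ℂ))
      (riemannZeta s - 1 / (s - 1)) := by
  have h := Complex.hasSum_taylorSeries_of_entire differentiable_riemannZeta₀ 1 s
  have e : riemannZeta s - 1 / (s - 1) = riemannZeta₀ s := by simp [riemannZeta₀, hs]
  rw [e]
  convert! h using 1
  funext k
  have hr : (stieltjesConstant k : ℂ) = (-1) ^ k * iteratedDeriv k riemannZeta₀ 1 := by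
    unfold stieltjesConstant
    rw [← Complex.conj_eq_iff_re, map_mul, ← iteratedDeriv_riemannZeta₀_conj]
    simp
  have h1 : ((-1 : ℂ) ^ k) * (-1) ^ k = 1 := by rw [← mul_pow]; simp
  rw [hr, ← mul_assoc, h1, smul_eq_mul, smul_eq_mul]
  ring

/-!
Write `ζ(s) = 1 / (s - 1) + ζ₀(s)` with `ζ₀` entire. As `ψ(1 - s) = ψ(2 - s) - 1 / (1 - s)`, the
poles at `s = 1` cancel and `F(s) = ζ₀(s) - ψ(2 - s)` on `(0, 1)` (`zetaSubDigamma_eq`). Hence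
`F' = ζ₀'(s) + ψ'(2 - s)` and `F'' = ζ₀''(s) - ψ''(2 - s)`, and convexity follows from two bounds.

* `-ψ''(x) > 1 / 4` for `1 < x < 2` (`deriv_trigammaSeries_lt`). Indeed `ψ'(x) = ∑ 1 / (x + n) ^ 2`,
  so `-ψ''(x) ≥ 2 / x ^ 3`. The series comes from the recurrence `ψ(x + 1) = ψ(x) + 1 / x` and the
  monotonicity of `ψ`, that is, from the convexity of `log Γ` (`hasSum_realDigamma_sub`).
* `ζ₀''(s) ≥ -1 / 4` for `s > 0` (`neg_le_re_deriv_deriv_riemannZeta₀`). By Euler–Maclaurin summation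
  (`riemannZeta₀_eq_fractMellin`), `ζ₀(s) = 1 / 2 + s (s + 1) ∫ B(t) t ^ (-s - 2)` over `t > 1`, where
  `B(t) = {t} (1 - {t}) / 2` lies in `[0, 1 / 8]`. In the second derivative of the right-hand side
  the only negative contribution is `-2 (2 s + 1) ∫ B(t) log t * t ^ (-s - 2)`, which is at least
  `-(2 s + 1) / (4 (s + 1) ^ 2)`.

The formula for `F'` extends continuously to `[0, 1]`. The limits follow from
`ζ'(0) = -log (2 π) / 2`, `ζ₀'(1) = -γ₁`, `ψ'(1) = π ^ 2 / 6` and `ψ'(2) = π ^ 2 / 6 - 1`. The limit at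
`0` is positive and `F'` is increasing, so `F' > 0`.
-/

/-! ### The digamma function on the positive reals -/

/-- The real digamma function, as the derivative of `log Γ`. -/
noncomputable def realDigamma : ℝ → ℝ := deriv (Real.log ∘ Real.Gamma)

theorem differentiableAt_log_Gamma {x : ℝ} (hx : 0 < x) :
    DifferentiableAt ℝ (Real.log ∘ Real.Gamma) x := by
  refine DifferentiableAt.log (Real.differentiableAt_Gamma fun m => ?_) (Real.Gamma_pos_of_pos hx).ne'
  have : (0 : ℝ) ≤ m := m.cast_nonneg
  linarith

theorem re_digamma_ofReal {x : ℝ} (hx : 0 < x) : (Complex.digamma x).re = realDigamma x := by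
  have hd : DifferentiableAt ℂ Complex.Gamma x := by
    refine Complex.differentiableAt_Gamma _ fun m h => ?_
    have h' : x = -m := by exact_mod_cast h
    have : (0 : ℝ) ≤ m := m.cast_nonneg
    linarith
  have h1 : HasDerivAt Real.Gamma (deriv Complex.Gamma x).re x := by
    have := hd.hasDerivAt.real_of_complex
    simpa only [Complex.Gamma_ofReal, Complex.ofReal_re] using this
  have h2 : HasDerivAt (Real.log ∘ Real.Gamma) ((deriv Complex.Gamma x).re / Real.Gamma x) x :=
    h1.log (Real.Gamma_pos_of_pos hx).ne'
  rw [Complex.digamma_def, logDeriv_apply, Complex.Gamma_ofReal, Complex.div_ofReal_re,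
    realDigamma, h2.deriv]

theorem monotoneOn_realDigamma : MonotoneOn realDigamma (Ioi 0) :=
  Real.convexOn_log_Gamma.monotoneOn_deriv fun _ hx => differentiableAt_log_Gamma hx

theorem realDigamma_add_one {x : ℝ} (hx : 0 < x) : realDigamma (x + 1) = realDigamma x + 1 / x := by
  have h := Complex.digamma_apply_add_one x fun m h => by
    have h' : x = -m := by exact_mod_cast h
    have : (0 : ℝ) ≤ m := m.cast_nonneg
    linarith
  have h' := congrArg Complex.re h
  rw [Complex.add_re, ← Complex.ofReal_one, ← Complex.ofReal_add, ← Complex.ofReal_inv,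
    Complex.ofReal_re, re_digamma_ofReal hx, re_digamma_ofReal (by linarith)] at h'
  simpa using h'

theorem realDigamma_add_nat {x : ℝ} (hx : 0 < x) (N : ℕ) :
    realDigamma (x + N) = realDigamma x + ∑ n ∈ Finset.range N, 1 / (x + n) := by
  induction N with
  | zero => simp
  | succ N ih =>
    rw [Finset.sum_range_succ, ← add_assoc, ← ih, ← realDigamma_add_one (by positivity)]
    push_cast; ring_nf

/-- On `[1, 2]` monotonicity of `ψ` pins `ψ (x + N) - ψ (1 + N)` between `0` and `1 / (1 + N)`, so
the recurrence telescopes to the partial fraction expansion. -/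
theorem hasSum_realDigamma_sub {x : ℝ} (hx : x ∈ Icc (1 : ℝ) 2) :
    HasSum (fun n : ℕ => 1 / (1 + n : ℝ) - 1 / (x + n)) (realDigamma x - realDigamma 1) := by
  have hx0 : 0 < x := by linarith [hx.1]
  rw [hasSum_iff_tendsto_nat_of_nonneg]
  · have key (N : ℕ) : ∑ n ∈ Finset.range N, (1 / (1 + n : ℝ) - 1 / (x + n)) =
        (realDigamma x - realDigamma 1) - (realDigamma (x + N) - realDigamma (1 + N)) := by
      rw [Finset.sum_sub_distrib, realDigamma_add_nat hx0, realDigamma_add_nat one_pos]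
      ring
    simp_rw [key]
    have h0 : Tendsto (fun N : ℕ => realDigamma (x + N) - realDigamma (1 + N)) atTop (𝓝 0) := by
      refine squeeze_zero (g := fun N : ℕ => 1 / ((N : ℝ) + 1)) (fun N => ?_) (fun N => ?_)
        tendsto_one_div_add_atTop_nhds_zero_nat
      · have hN : (0 : ℝ) ≤ N := N.cast_nonneg
        exact sub_nonneg.2 (monotoneOn_realDigamma (mem_Ioi.2 (by linarith))
          (mem_Ioi.2 (by linarith)) (by linarith [hx.1]))
      · have hN : (0 : ℝ) ≤ N := N.cast_nonneg
        have h1 := realDigamma_add_one (x := (N : ℝ) + 1) (by linarith)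
        have h2 : realDigamma (x + N) ≤ realDigamma ((N : ℝ) + 1 + 1) :=
          monotoneOn_realDigamma (mem_Ioi.2 (by linarith)) (mem_Ioi.2 (by linarith))
            (by linarith [hx.2])
        rw [add_comm (1 : ℝ)]
        linarith
    simpa using tendsto_const_nhds.sub h0
  · intro n
    have : (0 : ℝ) < 1 + n := by positivity
    exact sub_nonneg.2 (one_div_le_one_div_of_le this (by linarith [hx.1]))

theorem summable_one_div_add_nat_pow {k : ℕ} (hk : 1 < k) {x : ℝ} (hx : 0 < x) :
    Summable fun n : ℕ => 1 / (x + n) ^ k := by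
  have h := (Real.summable_one_div_nat_add_rpow x k).2 (by exact_mod_cast hk)
  refine h.congr fun n => ?_
  rw [Real.rpow_natCast, abs_of_pos (by positivity), add_comm]

/-- The trigamma function, as a series; it is only used for positive arguments. -/
noncomputable def trigammaSeries (x : ℝ) : ℝ := ∑' n : ℕ, 1 / (x + n) ^ 2

theorem hasDerivAt_one_div_add_sq {y : ℝ} (hy : 0 < y) (n : ℕ) :
    HasDerivAt (fun z : ℝ => 1 / (z + n) ^ 2) (-2 / (y + n) ^ 3) y := by
  have hy' : y + n ≠ 0 := by positivity
  have h := (((hasDerivAt_id' y).add_const (n : ℝ)).fun_pow 2).fun_inv (pow_ne_zero 2 hy')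
  simp only [one_div]
  refine h.congr_deriv ?_
  field_simp
  norm_num
  ring

theorem hasDerivAt_one_div_sub_one_div_add {y : ℝ} (hy : 0 < y) (n : ℕ) :
    HasDerivAt (fun z : ℝ => 1 / (1 + n : ℝ) - 1 / (z + n)) (1 / (y + n) ^ 2) y := by
  have hy' : y + n ≠ 0 := by positivity
  have h := (((hasDerivAt_id' y).add_const (n : ℝ)).fun_inv hy').const_sub (1 / (1 + n : ℝ))
  simp only [one_div] at h ⊢
  refine h.congr_deriv ?_
  field_simp

theorem hasDerivAt_trigammaSeries {x : ℝ} (hx : 0 < x) :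
    HasDerivAt trigammaSeries (∑' n : ℕ, -2 / (x + n) ^ 3) x := by
  have hx2 : 0 < x / 2 := by positivity
  have hbound (n : ℕ) (y : ℝ) (hy : y ∈ Ioi (x / 2)) :
      ‖-2 / (y + n) ^ 3‖ ≤ 2 * (1 / (x / 2 + n) ^ 3) := by
    have hy' : x / 2 < y := hy
    have hp : 0 < x / 2 + n := by positivity
    have hle : (x / 2 + n) ^ 3 ≤ (y + n) ^ 3 := pow_le_pow_left₀ hp.le (by linarith) 3
    rw [norm_div, norm_neg, Real.norm_ofNat, Real.norm_of_nonneg (le_trans (by positivity) hle),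
      mul_one_div]
    exact div_le_div_of_nonneg_left (by norm_num) (by positivity) hle
  have hx' : x ∈ Ioi (x / 2) := mem_Ioi.2 (by linarith)
  exact hasDerivAt_tsum_of_isPreconnected (g := fun (n : ℕ) (z : ℝ) => 1 / (z + n) ^ 2)
    ((summable_one_div_add_nat_pow (k := 3) (by norm_num) hx2).mul_left 2) isOpen_Ioi
    isPreconnected_Ioi (fun n y hy => hasDerivAt_one_div_add_sq (hx2.trans hy) n) hbound hx'
    (summable_one_div_add_nat_pow (k := 2) (by norm_num) hx) hx'

theorem hasDerivAt_realDigamma {x : ℝ} (hx : x ∈ Ioo (1 : ℝ) 2) :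
    HasDerivAt realDigamma (trigammaSeries x) x := by
  have hbound (n : ℕ) (y : ℝ) (hy : y ∈ Ioo (1 : ℝ) 2) :
      ‖1 / (y + n) ^ 2‖ ≤ 1 / (1 + n : ℝ) ^ 2 := by
    have hp : (0 : ℝ) < 1 + n := by positivity
    have hle : (1 + n : ℝ) ^ 2 ≤ (y + n) ^ 2 := pow_le_pow_left₀ hp.le (by linarith [hy.1]) 2
    rw [norm_div, norm_one, Real.norm_of_nonneg (sq_nonneg _)]
    exact one_div_le_one_div_of_le (by positivity) hle
  have h : HasDerivAt (fun y : ℝ => ∑' n : ℕ, (1 / (1 + n : ℝ) - 1 / (y + n)))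
      (trigammaSeries x) x :=
    hasDerivAt_tsum_of_isPreconnected
      (g := fun (n : ℕ) (z : ℝ) => 1 / (1 + n : ℝ) - 1 / (z + n))
      (summable_one_div_add_nat_pow (k := 2) (by norm_num) one_pos) isOpen_Ioo isPreconnected_Ioo
      (fun n y hy => hasDerivAt_one_div_sub_one_div_add (one_pos.trans hy.1) n) hbound hx
      (hasSum_realDigamma_sub (Ioo_subset_Icc_self hx)).summable hx
  refine (h.add_const (realDigamma 1)).congr_of_eventuallyEq ?_
  filter_upwards [isOpen_Ioo.mem_nhds hx] with y hy
  rw [(hasSum_realDigamma_sub (Ioo_subset_Icc_self hy)).tsum_eq]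
  ring

theorem hasSum_trigammaSeries_one : HasSum (fun n : ℕ => 1 / (1 + n : ℝ) ^ 2) (Real.pi ^ 2 / 6) := by
  have h := (hasSum_nat_add_iff' 1).2 hasSum_zeta_two
  simpa [add_comm] using h

theorem trigammaSeries_one : trigammaSeries 1 = Real.pi ^ 2 / 6 :=
  hasSum_trigammaSeries_one.tsum_eq

theorem trigammaSeries_two : trigammaSeries 2 = Real.pi ^ 2 / 6 - 1 := by
  have h := (hasSum_nat_add_iff' 1).2 hasSum_trigammaSeries_one
  rw [trigammaSeries, ← (by simpa using h.tsum_eq :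
    ∑' n : ℕ, 1 / (1 + ((n : ℝ) + 1)) ^ 2 = Real.pi ^ 2 / 6 - 1)]
  congr 1
  funext n
  ring_nf

/-- The term `n = 0` of the series for `-ψ''` alone exceeds `2 / 2 ^ 3`. -/
theorem deriv_trigammaSeries_lt {x : ℝ} (hx : x ∈ Ioo (1 : ℝ) 2) :
    deriv trigammaSeries x < -(1 / 4) := by
  have hx0 : 0 < x := by linarith [hx.1]
  have hs : Summable fun n : ℕ => 2 / (x + n) ^ 3 := by
    simpa only [mul_one_div] using
      (summable_one_div_add_nat_pow (k := 3) (by norm_num) hx0).mul_left 2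
  have h1 : 2 / x ^ 3 ≤ ∑' n : ℕ, 2 / (x + n) ^ 3 := by
    simpa using hs.le_tsum 0 fun n _ => by positivity
  have h2 : x ^ 3 < 2 ^ 3 := pow_lt_pow_left₀ hx.2 hx0.le (by norm_num)
  have h3 : 1 / 4 < 2 / x ^ 3 := by
    rw [lt_div_iff₀ (by positivity)]
    linarith
  rw [(hasDerivAt_trigammaSeries hx0).deriv]
  simp only [neg_div, tsum_neg]
  linarith

section EulerMaclaurin

open MeasureTheory Asymptotics

/-! ### Euler–Maclaurin summation for `ζ` in the half-plane of convergence -/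

/-- The periodic function `{t} (1 - {t}) / 2`, an antiderivative of `1 / 2 - {t}`. -/
noncomputable def fractParabola (t : ℝ) : ℝ := Int.fract t * (1 - Int.fract t) / 2

theorem fractParabola_nonneg (t : ℝ) : 0 ≤ fractParabola t := by
  have h0 := Int.fract_nonneg t
  have h1 := Int.fract_lt_one t
  have := mul_nonneg h0 (sub_nonneg.2 h1.le)
  unfold fractParabola
  positivity

theorem fractParabola_le (t : ℝ) : fractParabola t ≤ 1 / 8 := by
  unfold fractParabola
  nlinarith [sq_nonneg (Int.fract t - 1 / 2)]

theorem continuous_fractParabola : Continuous fractParabola := by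
  have h : Continuous ((fun u : ℝ => u * (1 - u) / 2) ∘ Int.fract) :=
    ContinuousOn.comp_fract'' (by fun_prop) (by norm_num)
  exact h

theorem hasDerivAt_fractParabola {t : ℝ} (ht : t ∉ range ((↑) : ℤ → ℝ)) :
    HasDerivAt fractParabola (1 / 2 - Int.fract t) t := by
  have hf : HasDerivAt (fun u : ℝ => Int.fract u) 1 t := by
    have h1 : HasDerivAt (fun u : ℝ => u - (⌊t⌋ : ℝ)) 1 t := (hasDerivAt_id t).sub_const _
    refine h1.congr_of_eventuallyEq ?_
    have hlt : (⌊t⌋ : ℝ) < t := lt_of_le_of_ne (Int.floor_le t) fun h => ht ⟨_, h⟩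
    filter_upwards [Ioo_mem_nhds hlt (Int.lt_floor_add_one t)] with u hu
    have : ⌊u⌋ = ⌊t⌋ := Int.floor_eq_iff.2 ⟨hu.1.le, hu.2⟩
    rw [Int.fract, this]
  have h := (hf.mul (hf.const_sub 1)).div_const 2
  refine h.congr_deriv ?_
  ring

theorem integrableOn_cpow_mul {s : ℂ} (hs : s.re < -1) {g : ℝ → ℝ} (hg : Measurable g)
    {C : ℝ} (hC : ∀ t, ‖g t‖ ≤ C) :
    IntegrableOn (fun t : ℝ => (g t : ℂ) * (t : ℂ) ^ s) (Ioi 1) := by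
  refine Integrable.bdd_mul (c := C) (integrableOn_Ioi_cpow_of_lt hs one_pos)
    (Complex.measurable_ofReal.comp hg).aestronglyMeasurable (ae_of_all _ fun t => ?_)
  simpa using hC t

theorem integrableOn_fract_mul_cpow {s : ℂ} (hs : 0 < s.re) :
    IntegrableOn (fun t : ℝ => ((1 / 2 - Int.fract t : ℝ) : ℂ) * (t : ℂ) ^ (-s - 1)) (Ioi 1) := by
  refine integrableOn_cpow_mul (by simp; linarith) (C := 1)
    (measurable_const.sub measurable_fract) fun t => ?_
  have h0 := Int.fract_nonneg t
  have h1 := Int.fract_lt_one t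
  rw [Real.norm_eq_abs, abs_le]
  constructor <;> linarith

/-- `∫ ((1 / 2 - {t}) t ^ (-s - 1) - (s + 1) B(t) t ^ (-s - 2)) = 0` with `B = fractParabola`: the
integrand is the derivative of `B(t) t ^ (-s - 1)` off the integers, which vanishes at both ends. -/
theorem integral_fract_mul_cpow {s : ℂ} (hs : 0 < s.re) :
    ∫ t in Ioi (1 : ℝ), ((1 / 2 - Int.fract t : ℝ) : ℂ) * (t : ℂ) ^ (-s - 1) =
      (s + 1) * ∫ t in Ioi (1 : ℝ), (fractParabola t : ℂ) * (t : ℂ) ^ (-s - 2) := by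
  have i1 := integrableOn_fract_mul_cpow hs
  have i2 : IntegrableOn (fun t : ℝ => (fractParabola t : ℂ) * (t : ℂ) ^ (-s - 2)) (Ioi 1) := by
    refine integrableOn_cpow_mul (by simp; linarith) (C := 1 / 8)
      continuous_fractParabola.measurable fun t => ?_
    rw [Real.norm_of_nonneg (fractParabola_nonneg t)]
    exact fractParabola_le t
  have i3 := i1.sub (i2.const_mul (s + 1))
  have hs1 : -s - 1 ≠ 0 := fun h => by
    have := congrArg Complex.re h
    simp at this
    linarith
  have ftc (N : ℕ) (hN : 1 ≤ N) : ∫ t in (1 : ℝ)..N,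
      (((1 / 2 - Int.fract t : ℝ) : ℂ) * (t : ℂ) ^ (-s - 1) -
        (s + 1) * ((fractParabola t : ℂ) * (t : ℂ) ^ (-s - 2))) = 0 := by
    have hN' : (1 : ℝ) ≤ N := by exact_mod_cast hN
    rw [integral_eq_of_hasDerivAt_off_countable_of_le
      (fun t : ℝ => (fractParabola t : ℂ) * (t : ℂ) ^ (-s - 1)) _ hN'
      (countable_range ((↑) : ℤ → ℝ))]
    · simp [fractParabola]
    · refine ContinuousOn.mul
        (Complex.continuous_ofReal.comp continuous_fractParabola).continuousOn fun t ht => ?_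
      exact (Complex.continuousAt_ofReal_cpow_const _ _
        (Or.inr (by linarith [ht.1]))).continuousWithinAt
    · rintro t ⟨ht, hti⟩
      have ht0 : t ≠ 0 := by linarith [ht.1]
      have h1 := (hasDerivAt_fractParabola hti).ofReal_comp
      have h2 := hasDerivAt_ofReal_cpow_const' (r := -s - 2) ht0 (by
        intro h
        apply hs1
        linear_combination h)
      have h3 : HasDerivAt (fun y : ℝ => (y : ℂ) ^ (-s - 1))
          ((-s - 1) * (t : ℂ) ^ (-s - 2)) t := by
        have h4 := h2.const_mul (-s - 1)
        rw [show -s - 2 + 1 = -s - 1 by ring] at h4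
        simpa only [mul_div_cancel₀ _ hs1] using h4
      refine (h1.mul h3).congr_deriv ?_
      ring
    · rw [intervalIntegrable_iff_integrableOn_Ioc_of_le hN']
      exact i3.mono_set Ioc_subset_Ioi_self
  have hlim := intervalIntegral_tendsto_integral_Ioi 1 i3 tendsto_natCast_atTop_atTop
  have h0 := tendsto_nhds_unique hlim (tendsto_const_nhds.congr' (by
    filter_upwards [eventually_ge_atTop 1] with N hN
    exact (ftc N hN).symm))
  simp only [Pi.sub_apply] at h0
  rw [integral_sub i1 (i2.const_mul _), integral_const_mul] at h0
  exact sub_eq_zero.1 h0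

theorem riemannZeta_eq_mul_integral {s : ℂ} (hs : 1 < s.re) :
    riemannZeta s = s * ∫ t in Ioi (1 : ℝ), (⌊t⌋₊ : ℂ) * (t : ℂ) ^ (-s - 1) := by
  have h := LSeries_eq_mul_integral_of_nonneg (fun _ => 1) (r := 1) zero_le_one hs (by
    simp only [Finset.sum_const, Nat.card_Icc, Real.rpow_one, nsmul_eq_mul]
    simpa using isBigO_refl _ _) (by simp)
  have h1 : LSeries (fun _ => ((1 : ℝ) : ℂ)) s = riemannZeta s := by
    rw [← LSeries_one_eq_riemannZeta hs]
    simp [Pi.one_def]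
  rw [← h1, h]
  simp [sub_eq_add_neg, add_comm]

theorem riemannZeta₀_eq_integral_of_one_lt_re {s : ℂ} (hs : 1 < s.re) :
    riemannZeta₀ s = 1 / 2 +
      s * (s + 1) * ∫ t in Ioi (1 : ℝ), (fractParabola t : ℂ) * (t : ℂ) ^ (-s - 2) := by
  have hs0 : s ≠ 0 := fun h => by simp [h] at hs; linarith
  have hs1 : s ≠ 1 := fun h => by simp [h] at hs
  have i1 := integrableOn_fract_mul_cpow (s := s) (by linarith)
  have i2 : IntegrableOn (fun t : ℝ => (t : ℂ) ^ (-s)) (Ioi 1) :=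
    integrableOn_Ioi_cpow_of_lt (by simpa using hs) one_pos
  have i3 : IntegrableOn (fun t : ℝ => (1 / 2 : ℂ) * (t : ℂ) ^ (-s - 1)) (Ioi 1) :=
    (integrableOn_Ioi_cpow_of_lt (by simp; linarith) one_pos).const_mul _
  have hsplit : ∫ t in Ioi (1 : ℝ), (⌊t⌋₊ : ℂ) * (t : ℂ) ^ (-s - 1) =
      (∫ t in Ioi (1 : ℝ), (t : ℂ) ^ (-s)) - (∫ t in Ioi (1 : ℝ), (1 / 2 : ℂ) * (t : ℂ) ^ (-s - 1))
      + ∫ t in Ioi (1 : ℝ), ((1 / 2 - Int.fract t : ℝ) : ℂ) * (t : ℂ) ^ (-s - 1) := by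
    have i4 : IntegrableOn (fun t : ℝ => (t : ℂ) ^ (-s) - (1 / 2 : ℂ) * (t : ℂ) ^ (-s - 1)) (Ioi 1) :=
      i2.sub i3
    rw [← integral_sub i2 i3, ← integral_add i4 i1]
    refine setIntegral_congr_fun measurableSet_Ioi fun t ht => ?_
    have ht0 : (0 : ℝ) < t := one_pos.trans ht
    have hfl : ((⌊t⌋₊ : ℝ) : ℂ) = ((t - Int.fract t : ℝ) : ℂ) := by
      rw [natCast_floor_eq_intCast_floor ht0.le, Int.self_sub_fract]
    have hc : (t : ℂ) ^ (-s) = t * (t : ℂ) ^ (-s - 1) := by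
      rw [Complex.cpow_sub _ _ (by exact_mod_cast ht0.ne'), Complex.cpow_one,
        mul_div_cancel₀ _ (by exact_mod_cast ht0.ne')]
    simp only [Complex.ofReal_natCast] at hfl
    rw [hfl, hc]
    push_cast
    ring
  rw [riemannZeta₀, if_neg hs1, riemannZeta_eq_mul_integral hs, hsplit,
    integral_fract_mul_cpow (by linarith), integral_const_mul,
    integral_Ioi_cpow_of_lt (by simpa using hs) one_pos,
    integral_Ioi_cpow_of_lt (by simp; linarith) one_pos]
  have h1 : -s + 1 ≠ 0 := fun h => hs1 (by linear_combination -h)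
  have h2 : s - 1 ≠ 0 := sub_ne_zero.2 hs1
  simp only [Complex.ofReal_one, Complex.one_cpow, sub_add_cancel]
  field_simp
  ring

/-! ### Continuation to `0 < re s` and the second derivative -/

/-- `{t} (1 - {t}) / 2` on `t > 1`, and `0` elsewhere, so that integrals over `(1, ∞)` become Mellin
transforms. -/
noncomputable def fractKernel : ℝ → ℝ := (Ioi 1).indicator fractParabola

theorem fractKernel_nonneg (t : ℝ) : 0 ≤ fractKernel t :=
  indicator_nonneg (fun t _ => fractParabola_nonneg t) t

theorem fractKernel_le (t : ℝ) : fractKernel t ≤ 1 / 8 :=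
  indicator_le' (fun t _ => fractParabola_le t) (fun _ _ => by norm_num) t

theorem measurable_fractKernel : Measurable fractKernel :=
  continuous_fractParabola.measurable.indicator measurableSet_Ioi

theorem fractKernel_of_le {t : ℝ} (ht : t ≤ 1) : fractKernel t = 0 :=
  indicator_of_notMem (by simpa using ht) _

theorem locallyIntegrable_fractKernel : LocallyIntegrable fractKernel := by
  refine (locallyIntegrable_const (1 / 8 : ℝ)).mono
    measurable_fractKernel.aestronglyMeasurable (ae_of_all _ fun t => ?_)
  rw [Real.norm_of_nonneg (fractKernel_nonneg t), Real.norm_of_nonneg (by norm_num)]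
  exact fractKernel_le t

theorem locallyIntegrableOn_log_smul {f : ℝ → ℂ} (hf : LocallyIntegrableOn f (Ioi 0)) :
    LocallyIntegrableOn (fun t => Real.log t • f t) (Ioi 0) :=
  hf.continuousOn_smul isLocallyClosed_Ioi
    (Real.continuousOn_log.mono fun _ ht => (mem_Ioi.1 ht).ne')

/-- The Mellin transform of `log ^ k * fractKernel`. -/
noncomputable def fractMellin (k : ℕ) : ℂ → ℂ :=
  mellin fun t => ((Real.log t ^ k * fractKernel t : ℝ) : ℂ)

theorem hasDerivAt_fractMellin (k : ℕ) {z : ℂ} (hz : z.re < -1) :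
    HasDerivAt (fractMellin k) (fractMellin (k + 1) z) z := by
  have hloc : LocallyIntegrableOn (fun t => ((Real.log t ^ k * fractKernel t : ℝ) : ℂ))
      (Ioi 0) := by
    induction k with
    | zero =>
      have h : LocallyIntegrable (fun t => (fractKernel t : ℂ)) := fun x =>
        (locallyIntegrable_fractKernel x).imp fun _ h => ⟨h.1, h.2.ofReal⟩
      simpa using h.locallyIntegrableOn _
    | succ k ih =>
      refine (locallyIntegrableOn_log_smul ih).congr (ae_of_all _ fun t => ?_)
      simp only [Complex.real_smul, ← Complex.ofReal_mul]
      ring_nf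
  -- Growth `O(t)` at infinity is far from optimal, but `re z < -1` already covers `re s > 0` in
  -- `z = -s - 1`.
  have htop : (fun t => ((Real.log t ^ k * fractKernel t : ℝ) : ℂ)) =O[atTop]
      fun t : ℝ => t ^ (-(-1 : ℝ)) := by
    have h1 : (fun t : ℝ => Real.log t ^ k) =O[atTop] fun t : ℝ => t ^ (-(-1 : ℝ)) := by
      simpa [Function.id_def] using (Real.isLittleO_pow_log_id_atTop (n := k)).isBigO
    refine IsBigO.trans (IsBigO.of_bound (1 / 8) (Eventually.of_forall fun t => ?_)) h1
    rw [Complex.norm_real, norm_mul, mul_comm, Real.norm_of_nonneg (fractKernel_nonneg t)]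
    exact mul_le_mul_of_nonneg_right (fractKernel_le t) (norm_nonneg _)
  -- The kernel vanishes near `0`, so any exponent below `re z` will do there.
  have hbot : (fun t => ((Real.log t ^ k * fractKernel t : ℝ) : ℂ)) =O[𝓝[>] 0]
      fun t : ℝ => t ^ (-(z.re - 1)) := by
    refine IsBigO.congr' (isBigO_zero _ _) ?_ EventuallyEq.rfl
    filter_upwards [nhdsWithin_le_nhds (Iio_mem_nhds (zero_lt_one (α := ℝ)))] with t ht
    simp [fractKernel_of_le (mem_Iio.1 ht).le]
  have h := (mellin_hasDerivAt_of_isBigO_rpow hloc htop hz hbot (sub_one_lt _)).2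
  refine h.congr_deriv (congrArg (fun f : ℝ → ℂ => mellin f z) (funext fun t => ?_))
  rw [Complex.real_smul, ← Complex.ofReal_mul]
  ring_nf

theorem fractMellin_zero_eq (s : ℂ) : fractMellin 0 (-s - 1) =
    ∫ t in Ioi (1 : ℝ), (fractParabola t : ℂ) * (t : ℂ) ^ (-s - 2) := by
  have h : (fun t : ℝ => (t : ℂ) ^ (-s - 1 - 1) • ((Real.log t ^ 0 * fractKernel t : ℝ) : ℂ)) =
      (Ioi (1 : ℝ)).indicator fun t => (fractParabola t : ℂ) * (t : ℂ) ^ (-s - 2) := by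
    funext t
    by_cases ht : t ∈ Ioi (1 : ℝ)
    · simp only [fractKernel, indicator_of_mem ht, pow_zero, one_mul, smul_eq_mul]
      ring_nf
    · simp [fractKernel, indicator_of_notMem ht]
  rw [fractMellin, mellin, h, setIntegral_indicator measurableSet_Ioi,
    Ioi_inter_Ioi, max_eq_right zero_le_one]

theorem hasDerivAt_fractMellin_comp (k : ℕ) {s : ℂ} (hs : 0 < s.re) :
    HasDerivAt (fun w => fractMellin k (-w - 1)) (-fractMellin (k + 1) (-s - 1)) s := by
  have h1 : HasDerivAt (fun w : ℂ => -w - 1) (-1) s := (hasDerivAt_id' s).neg.sub_const 1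
  have h2 := (hasDerivAt_fractMellin k (z := -s - 1) (by simp; linarith)).comp s h1
  exact h2.congr_deriv (by ring)

theorem isOpen_zero_lt_re : IsOpen {s : ℂ | 0 < s.re} :=
  isOpen_lt continuous_const Complex.continuous_re

/-- The Euler–Maclaurin formula for `ζ`, continued from `1 < re s` to `0 < re s`. -/
theorem riemannZeta₀_eq_fractMellin {s : ℂ} (hs : 0 < s.re) :
    riemannZeta₀ s = 1 / 2 + s * (s + 1) * fractMellin 0 (-s - 1) := by
  have hg : DifferentiableOn ℂ (fun s => 1 / 2 + s * (s + 1) * fractMellin 0 (-s - 1))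
      {s : ℂ | 0 < s.re} := fun w hw =>
    (((differentiableAt_id.mul (differentiableAt_id.add_const 1)).mul
      (hasDerivAt_fractMellin_comp 0 hw).differentiableAt).const_add _).differentiableWithinAt
  refine ((differentiable_riemannZeta₀.differentiableOn.analyticOnNhd
    isOpen_zero_lt_re).eqOn_of_preconnected_of_eventuallyEq (hg.analyticOnNhd isOpen_zero_lt_re)
    (convex_halfSpace_re_gt 0).isPreconnected (z₀ := 2) (by simp) ?_) hs
  have h2 : {s : ℂ | 1 < s.re} ∈ 𝓝 (2 : ℂ) :=
    (isOpen_lt continuous_const Complex.continuous_re).mem_nhds (by simp)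
  filter_upwards [h2] with w hw
  rw [riemannZeta₀_eq_integral_of_one_lt_re hw, fractMellin_zero_eq]

theorem deriv_deriv_riemannZeta₀ {s : ℂ} (hs : 0 < s.re) :
    deriv (deriv riemannZeta₀) s = 2 * fractMellin 0 (-s - 1)
      - 2 * (2 * s + 1) * fractMellin 1 (-s - 1) + s * (s + 1) * fractMellin 2 (-s - 1) := by
  have hq (w : ℂ) : HasDerivAt (fun w : ℂ => w * (w + 1)) (2 * w + 1) w := by
    refine ((hasDerivAt_id' w).fun_mul ((hasDerivAt_id' w).add_const 1)).congr_deriv ?_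
    ring
  have hl : HasDerivAt (fun w : ℂ => 2 * w + 1) 2 s := by
    simpa using ((hasDerivAt_id' s).const_mul 2).add_const 1
  have h1 : deriv riemannZeta₀ =ᶠ[𝓝 s] fun w => (2 * w + 1) * fractMellin 0 (-w - 1) +
      w * (w + 1) * (-fractMellin 1 (-w - 1)) := by
    filter_upwards [isOpen_zero_lt_re.mem_nhds hs] with w hw
    have he : riemannZeta₀ =ᶠ[𝓝 w] fun s => 1 / 2 + s * (s + 1) * fractMellin 0 (-s - 1) := by
      filter_upwards [isOpen_zero_lt_re.mem_nhds hw] with v hv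
      exact riemannZeta₀_eq_fractMellin hv
    rw [he.deriv_eq]
    exact (((hq w).fun_mul (hasDerivAt_fractMellin_comp 0 hw)).const_add _).deriv
  rw [h1.deriv_eq]
  have h2 := (hl.fun_mul (hasDerivAt_fractMellin_comp 0 hs)).fun_add
    ((hq s).fun_mul (hasDerivAt_fractMellin_comp 1 hs).fun_neg)
  rw [h2.deriv]
  ring

theorem fractMellin_ofReal (k : ℕ) (x : ℝ) : fractMellin k x =
    ((∫ t in Ioi (1 : ℝ), Real.log t ^ k * fractParabola t * t ^ (x - 1) : ℝ) : ℂ) := by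
  have h : EqOn
      (fun t : ℝ => (t : ℂ) ^ ((x : ℂ) - 1) • ((Real.log t ^ k * fractKernel t : ℝ) : ℂ))
      (fun t => (((Ioi (1 : ℝ)).indicator
        (fun t => Real.log t ^ k * fractParabola t * t ^ (x - 1)) t : ℝ) : ℂ)) (Ioi 0) := by
    intro t ht
    by_cases h1 : t ∈ Ioi (1 : ℝ)
    · simp only [fractKernel, indicator_of_mem h1, smul_eq_mul]
      rw [Complex.ofReal_mul (_ * _), Complex.ofReal_cpow (le_of_lt ht), mul_comm]
      simp
    · simp [fractKernel, indicator_of_notMem h1]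
  rw [fractMellin, mellin, setIntegral_congr_fun measurableSet_Ioi h, integral_complex_ofReal,
    setIntegral_indicator measurableSet_Ioi, Ioi_inter_Ioi, max_eq_right zero_le_one]

theorem fractMellin_ofReal_re_nonneg (k : ℕ) (x : ℝ) : 0 ≤ (fractMellin k x).re := by
  rw [fractMellin_ofReal, Complex.ofReal_re]
  refine setIntegral_nonneg measurableSet_Ioi fun t ht => ?_
  have h1 : 1 < t := ht
  have := Real.log_nonneg h1.le
  have := fractParabola_nonneg t
  positivity

/-- The antiderivative is `-(log t / b + 1 / b ^ 2) t ^ (-b)`. -/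
theorem integral_log_mul_rpow {b : ℝ} (hb : 0 < b) :
    IntegrableOn (fun t : ℝ => Real.log t * t ^ (-b - 1)) (Ioi 1) ∧
      ∫ t in Ioi (1 : ℝ), Real.log t * t ^ (-b - 1) = 1 / b ^ 2 := by
  have hd (t : ℝ) (ht : t ∈ Ici (1 : ℝ)) : HasDerivAt
      (fun t : ℝ => -(1 / b) * (Real.log t * t ^ (-b)) - 1 / b ^ 2 * t ^ (-b))
      (Real.log t * t ^ (-b - 1)) t := by
    have ht0 : t ≠ 0 := by linarith [mem_Ici.1 ht]
    have h1 := Real.hasDerivAt_rpow_const (x := t) (p := -b) (Or.inl ht0)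
    have h2 := (((Real.hasDerivAt_log ht0).fun_mul h1).const_mul (-(1 / b))).fun_sub
      (h1.const_mul (1 / b ^ 2))
    refine h2.congr_deriv ?_
    rw [show t ^ (-b) = t * t ^ (-b - 1) by
      rw [Real.rpow_sub_one ht0, mul_div_cancel₀ _ ht0]]
    field_simp
    ring
  have hlim : Tendsto (fun t : ℝ => -(1 / b) * (Real.log t * t ^ (-b)) - 1 / b ^ 2 * t ^ (-b))
      atTop (𝓝 0) := by
    have h1 := tendsto_rpow_neg_atTop hb
    have h2 : Tendsto (fun t : ℝ => Real.log t * t ^ (-b)) atTop (𝓝 0) := by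
      refine (isLittleO_log_rpow_atTop hb).tendsto_div_nhds_zero.congr' ?_
      filter_upwards [eventually_gt_atTop 0] with t ht
      rw [Real.rpow_neg ht.le, div_eq_mul_inv]
    simpa only [mul_zero, sub_zero] using
      (h2.const_mul (-(1 / b))).sub (h1.const_mul (1 / b ^ 2))
  have hpos (t : ℝ) (ht : t ∈ Ioi (1 : ℝ)) : 0 ≤ Real.log t * t ^ (-b - 1) := by
    have h1 : 1 < t := ht
    have := Real.log_nonneg h1.le
    positivity
  refine ⟨integrableOn_Ioi_deriv_of_nonneg' hd hpos hlim, ?_⟩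
  rw [integral_Ioi_of_hasDerivAt_of_nonneg' hd hpos hlim]
  simp

theorem fractMellin_one_ofReal_re_le {s : ℝ} (hs : 0 < s) :
    (fractMellin 1 ((-s - 1 : ℝ) : ℂ)).re ≤ 1 / (8 * (s + 1) ^ 2) := by
  obtain ⟨hi, hv⟩ := integral_log_mul_rpow (b := s + 1) (by linarith)
  rw [fractMellin_ofReal, Complex.ofReal_re, show 1 / (8 * (s + 1) ^ 2) =
    1 / 8 * (1 / (s + 1) ^ 2) by rw [one_div_mul_one_div], ← hv, ← integral_const_mul]
  refine integral_mono_of_nonneg ?_ (hi.const_mul (1 / 8)) ?_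
  all_goals
    filter_upwards [ae_restrict_mem measurableSet_Ioi] with t ht
    have h1 : 1 < t := ht
    have h2 := Real.log_nonneg h1.le
    have h3 := fractParabola_nonneg t
  · simp only [Pi.zero_apply]
    positivity
  · have h4 : 0 ≤ Real.log t * t ^ (-(s + 1) - 1) := by positivity
    have h5 := mul_le_mul_of_nonneg_right (fractParabola_le t) h4
    rw [show -s - 1 - 1 = -(s + 1) - 1 by ring]
    linarith

/-- In `deriv_deriv_riemannZeta₀` only the middle term is negative at a real point, and it is at most
`(2 s + 1) / (4 (s + 1) ^ 2) ≤ 1 / 4` in absolute value. -/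
theorem neg_le_re_deriv_deriv_riemannZeta₀ {s : ℝ} (hs : 0 < s) :
    -(1 / 4) ≤ (deriv (deriv riemannZeta₀) s).re := by
  have e : (-(s : ℂ) - 1) = ((-s - 1 : ℝ) : ℂ) := by push_cast; ring
  have h0 := fractMellin_ofReal_re_nonneg 0 (-s - 1)
  have h1 := fractMellin_one_ofReal_re_le hs
  have h2 := fractMellin_ofReal_re_nonneg 2 (-s - 1)
  rw [deriv_deriv_riemannZeta₀ (by simpa using hs), e,
    show (2 * (2 * (s : ℂ) + 1)) = ((2 * (2 * s + 1) : ℝ) : ℂ) by push_cast; ring,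
    show (s : ℂ) * (s + 1) = ((s * (s + 1) : ℝ) : ℂ) by push_cast; ring,
    show (2 : ℂ) = ((2 : ℝ) : ℂ) by norm_num]
  simp only [Complex.add_re, Complex.sub_re, Complex.re_ofReal_mul]
  have h3 := mul_le_mul_of_nonneg_left h1 (show 0 ≤ 2 * (2 * s + 1) by positivity)
  have h4 := mul_nonneg (show 0 ≤ s * (s + 1) by positivity) h2
  have h5 : 2 * (2 * s + 1) * (1 / (8 * (s + 1) ^ 2)) ≤ 1 / 4 := by
    rw [mul_one_div, div_le_div_iff₀ (by positivity) (by norm_num)]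
    nlinarith [sq_nonneg s]
  linarith

end EulerMaclaurin

/-! ### The function `ζ(s) - ψ(1 - s)` on `(0, 1)` -/

/-- The poles of `ζ(s)` and `ψ(1 - s)` at `s = 1` cancel. -/
theorem zetaSubDigamma_eq {s : ℝ} (hs : s ∈ Ioo (0 : ℝ) 1) :
    zetaSubDigamma s = (riemannZeta₀ s).re - realDigamma (2 - s) := by
  have hs1 : (s : ℂ) ≠ 1 := by exact_mod_cast hs.2.ne
  have h1 : (riemannZeta s).re = (s - 1)⁻¹ + (riemannZeta₀ s).re := by
    rw [riemannZeta_eq_inv_sub_add hs1, Complex.add_re,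
      show ((s : ℂ) - 1)⁻¹ = (((s - 1)⁻¹ : ℝ) : ℂ) by push_cast; rfl, Complex.ofReal_re]
  have h2 := realDigamma_add_one (x := 1 - s) (by linarith [hs.2])
  rw [show 1 - s + 1 = 2 - s by ring] at h2
  rw [zetaSubDigamma, Complex.sub_re, h1,
    show (1 : ℂ) - s = ((1 - s : ℝ) : ℂ) by push_cast; rfl,
    re_digamma_ofReal (by linarith [hs.2]), h2, ← neg_sub 1 s, inv_neg, one_div]
  ring

/-- For `s ∈ (0, 1)` the argument `2 - s` lies in `(1, 2)`, where the series for `ψ'` is available. -/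
theorem hasDerivAt_zetaSubDigamma {s : ℝ} (hs : s ∈ Ioo (0 : ℝ) 1) :
    HasDerivAt zetaSubDigamma ((deriv riemannZeta₀ s).re + trigammaSeries (2 - s)) s := by
  have h1 := (differentiable_riemannZeta₀ (s : ℂ)).hasDerivAt.real_of_complex
  have h2 := (hasDerivAt_realDigamma (x := 2 - s)
    ⟨by linarith [hs.2], by linarith [hs.1]⟩).comp_const_sub 2 s
  refine ((h1.fun_sub h2).congr_deriv (sub_neg_eq_add _ _)).congr_of_eventuallyEq ?_
  filter_upwards [isOpen_Ioo.mem_nhds hs] with t ht using zetaSubDigamma_eq ht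

/-- The derivative of `F` on `(0, 1)`, in a form that makes sense on a neighbourhood of `[0, 1]`. -/
noncomputable def zetaSubDigammaDeriv (s : ℝ) : ℝ :=
  (deriv riemannZeta₀ s).re + trigammaSeries (2 - s)

theorem hasDerivAt_zetaSubDigammaDeriv {s : ℝ} (hs : s < 2) : HasDerivAt zetaSubDigammaDeriv
    ((deriv (deriv riemannZeta₀) s).re - deriv trigammaSeries (2 - s)) s := by
  have h1 := (differentiable_riemannZeta₀.deriv (s : ℂ)).hasDerivAt.real_of_complex
  have h2 := (hasDerivAt_trigammaSeries (x := 2 - s)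
    (by linarith)).differentiableAt.hasDerivAt.comp_const_sub 2 s
  exact (h1.fun_add h2).congr_deriv (by ring)

theorem deriv_zetaSubDigamma_eqOn : EqOn (deriv zetaSubDigamma) zetaSubDigammaDeriv (Ioo 0 1) :=
  fun _ hs => (hasDerivAt_zetaSubDigamma hs).deriv

theorem deriv_deriv_zetaSubDigamma_pos {s : ℝ} (hs : s ∈ Ioo (0 : ℝ) 1) :
    0 < deriv (deriv zetaSubDigamma) s := by
  have he : deriv zetaSubDigamma =ᶠ[𝓝 s] zetaSubDigammaDeriv :=
    deriv_zetaSubDigamma_eqOn.eventuallyEq_of_mem (isOpen_Ioo.mem_nhds hs)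
  rw [he.deriv_eq, (hasDerivAt_zetaSubDigammaDeriv (by linarith [hs.2])).deriv]
  have h1 := neg_le_re_deriv_deriv_riemannZeta₀ hs.1
  have h2 := deriv_trigammaSeries_lt (x := 2 - s) ⟨by linarith [hs.2], by linarith [hs.1]⟩
  linarith

theorem zetaSubDigammaDeriv_zero :
    zetaSubDigammaDeriv 0 = Real.pi ^ 2 / 6 - 1 / 2 * Real.log (2 * Real.pi) := by
  have h := deriv_riemannZeta_eq_neg_inv_sub_sq_add (s := 0) zero_ne_one
  rw [deriv_riemannZeta_zero] at h
  have h1 : deriv riemannZeta₀ 0 = ((1 - 1 / 2 * Real.log (2 * Real.pi) : ℝ) : ℂ) := by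
    have h2 : ((Real.log (2 * Real.pi) : ℝ) : ℂ) = Complex.log (2 * Real.pi) := by
      rw [Complex.ofReal_log (by positivity)]
      push_cast
      rfl
    push_cast [h2]
    norm_num at h
    linear_combination -h
  rw [zetaSubDigammaDeriv, Complex.ofReal_zero, h1, Complex.ofReal_re, sub_zero,
    trigammaSeries_two]
  ring

theorem zetaSubDigammaDeriv_one :
    zetaSubDigammaDeriv 1 = Real.pi ^ 2 / 6 - stieltjesConstant 1 := by
  rw [zetaSubDigammaDeriv, stieltjesConstant, iteratedDeriv_one, show (2 : ℝ) - 1 = 1 by norm_num,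
    trigammaSeries_one]
  simp
  ring

theorem tendsto_deriv_zetaSubDigamma_zero : Tendsto (deriv zetaSubDigamma) (𝓝[>] 0)
    (𝓝 (Real.pi ^ 2 / 6 - 1 / 2 * Real.log (2 * Real.pi))) := by
  rw [← zetaSubDigammaDeriv_zero]
  refine ((hasDerivAt_zetaSubDigammaDeriv (by norm_num)).continuousAt.tendsto.mono_left
    nhdsWithin_le_nhds).congr' ?_
  filter_upwards [Ioo_mem_nhdsGT one_pos] with s hs using (deriv_zetaSubDigamma_eqOn hs).symm

theorem tendsto_deriv_zetaSubDigamma_one : Tendsto (deriv zetaSubDigamma) (𝓝[<] 1)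
    (𝓝 (Real.pi ^ 2 / 6 - stieltjesConstant 1)) := by
  rw [← zetaSubDigammaDeriv_one]
  refine ((hasDerivAt_zetaSubDigammaDeriv (by norm_num)).continuousAt.tendsto.mono_left
    nhdsWithin_le_nhds).congr' ?_
  filter_upwards [Ioo_mem_nhdsLT one_pos] with s hs using (deriv_zetaSubDigamma_eqOn hs).symm

/-- The crude bounds `π > 3` and `2 π < 2.7 ^ 3 < e ^ 3` place `3 / 2` between the two terms. -/
theorem pi_sq_div_six_sub_log_pos : 0 < Real.pi ^ 2 / 6 - 1 / 2 * Real.log (2 * Real.pi) := by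
  have h1 := Real.pi_gt_three
  have h2 : Real.log (2 * Real.pi) < 3 := by
    rw [Real.log_lt_iff_lt_exp (by positivity)]
    have h3 : (2.7 : ℝ) ^ 3 < Real.exp 1 ^ 3 :=
      pow_lt_pow_left₀ (by linarith [Real.exp_one_gt_d9]) (by norm_num) (by norm_num)
    rw [← Real.exp_nat_mul] at h3
    norm_num at h3
    linarith [Real.pi_le_four]
  nlinarith

/-- `F'` increases on `(0, 1)` from its positive limit at `0`. -/
theorem deriv_zetaSubDigamma_pos {s : ℝ} (hs : s ∈ Ioo (0 : ℝ) 1) :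
    0 < deriv zetaSubDigamma s := by
  have hmono : StrictMonoOn (deriv zetaSubDigamma) (Ioo 0 1) := by
    refine strictMonoOn_of_deriv_pos (convex_Ioo 0 1) (fun t ht => ?_) fun t ht => ?_
    · exact ((hasDerivAt_zetaSubDigammaDeriv (by linarith [ht.2])).continuousAt.continuousWithinAt
        ).congr (fun _ => deriv_zetaSubDigamma_eqOn.eq_of_mem) (deriv_zetaSubDigamma_eqOn ht)
    · exact deriv_deriv_zetaSubDigamma_pos (interior_subset ht)
  refine pi_sq_div_six_sub_log_pos.trans_le
    (le_of_tendsto tendsto_deriv_zetaSubDigamma_zero ?_)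
  filter_upwards [Ioo_mem_nhdsGT hs.1] with t ht
  exact (hmono ⟨ht.1, ht.2.trans hs.2⟩ hs ht.2).le

theorem theorem1p1 :
    ((∀ s ∈ Ioo (0 : ℝ) 1, 0 < deriv (deriv zetaSubDigamma) s) ∧
      StrictConvexOn ℝ (Ioo (0 : ℝ) 1) zetaSubDigamma) ∧
    ((∀ s ∈ Ioo (0 : ℝ) 1, 0 < deriv zetaSubDigamma s) ∧
      StrictMonoOn zetaSubDigamma (Ioo (0 : ℝ) 1)) ∧
    (Tendsto (deriv zetaSubDigamma) (𝓝[>] 0)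
        (𝓝 (Real.pi ^ 2 / 6 - 1 / 2 * Real.log (2 * Real.pi))) ∧
      Tendsto (deriv zetaSubDigamma) (𝓝[<] 1)
        (𝓝 (Real.pi ^ 2 / 6 - stieltjesConstant 1))) := by
  have hcont : ContinuousOn zetaSubDigamma (Ioo 0 1) := fun s hs =>
    (hasDerivAt_zetaSubDigamma hs).continuousAt.continuousWithinAt
  refine ⟨⟨fun s hs => deriv_deriv_zetaSubDigamma_pos hs, ?_⟩,
    ⟨fun s hs => deriv_zetaSubDigamma_pos hs, ?_⟩,
    tendsto_deriv_zetaSubDigamma_zero, tendsto_deriv_zetaSubDigamma_one⟩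
  · refine strictConvexOn_of_deriv2_pos (convex_Ioo 0 1) hcont fun s hs => ?_
    exact deriv_deriv_zetaSubDigamma_pos (interior_subset hs)
  · refine strictMonoOn_of_deriv_pos (convex_Ioo 0 1) hcont fun s hs => ?_
    exact deriv_zetaSubDigamma_pos (interior_subset hs)
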